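/- Let $n\ge 2$ and $l\ge 1$ be integers, and let $\Omega\subset\mathbb R^n$ be a bounded domain (a nonempty connected bounded open set) of volume $|\Omega|$. Let $\lambda_1\le\lambda_2\le\cdots$ be the eigenvalues, each repeated according to its multiplicity, of the Dirichlet problem for the polyharmonic operator $$(-\Delta)^l u=\lambda u \ \text{ in } \Omega,\qquad u=\frac{\partial u}{\partial\nu}=\cdots=\frac{\partial^{l-1}u}{\partial\nu^{l-1}}=0\ \text{ on }\partial\Omega,$$ understood in the weak sense: $u$ belongs to $H^l_0(\Omega)$, the closure of $C_c^\infty(\Omega)$ in the Sobolev space $H^l(\Omega)$, and $\int_\Omega u\,(-\Delta)^l\varphi\,dx=\lambda\int_\Omega u\,\varphi\,dx$ for all $\varphi\in C_c^\infty(\Omega)$. Then all $\lambda_j$ are positive and, for every real $p$ with $0<p<\frac{n}{2l}$ and every $k\in\mathbb N$, $$\sum_{j=1}^k\lambda_j^{-p}\ \le\ (4\pi)^{-lp}\,\frac{n}{n-2lp}\left(\frac{|\Omega|}{\Gamma\left(1+\frac n2\right)}\right)^{\frac{2lp}{n}}k^{\,1-\frac{2lp}{n}}.$$ -/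

import Mathlib

open scoped Distributions LineDeriv
open MeasureTheory TopologicalSpace

noncomputable section

namespace Polyharmonic

variable {n : ℕ}

/-- The real Hilbert space `L²(Ω)`. -/
abbrev L2 (Ω : Opens (EuclideanSpace ℝ (Fin n))) : Type :=
  Lp ℝ 2 (volume.restrict (Ω : Set (EuclideanSpace ℝ (Fin n))))

/-- The inclusion of the test functions `C_c^∞(Ω)` in `L²(Ω)`. -/
def toL2 (Ω : Opens (EuclideanSpace ℝ (Fin n))) : 𝓓(Ω, ℝ) →ₗ[ℝ] L2 Ω where
  toFun φ := (φ.continuous.memLp_of_hasCompactSupport φ.hasCompactSupport).toLp φ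
  map_add' _ _ := rfl
  map_smul' _ _ := rfl

/-- The partial derivative `∂_{s 0} ⋯ ∂_{s (i-1)} φ`, of order `i`, of a test function. -/
def partialDeriv {Ω : Opens (EuclideanSpace ℝ (Fin n))} {i : ℕ} (s : Fin i → Fin n)
    (φ : 𝓓(Ω, ℝ)) : 𝓓(Ω, ℝ) :=
  ∂^{fun j => EuclideanSpace.single (s j) (1 : ℝ)} φ

/-- `g` is the weak derivative `∂_s u` on `Ω`:
`∫_Ω u ∂_s φ = (-1)^i ∫_Ω g φ` for all test functions `φ`. -/
def HasWeakDeriv {Ω : Opens (EuclideanSpace ℝ (Fin n))} {i : ℕ} (s : Fin i → Fin n)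
    (u g : L2 Ω) : Prop :=
  ∀ φ : 𝓓(Ω, ℝ),
    inner ℝ u (toL2 Ω (partialDeriv s φ)) = (-1 : ℝ) ^ i * inner ℝ g (toL2 Ω φ)

/-- `u ∈ H_0^l(Ω)`: the function `u` has weak derivatives `g i s` in `L²(Ω)` for all orders
`i ≤ l`, and it is the limit in `H^l(Ω)` of a sequence of test functions. -/
def MemSobolevZero (Ω : Opens (EuclideanSpace ℝ (Fin n))) (l : ℕ) (u : L2 Ω) : Prop :=
  ∃ g : (i : ℕ) → (Fin i → Fin n) → L2 Ω,
    (∀ i ≤ l, ∀ s : Fin i → Fin n, HasWeakDeriv s u (g i s)) ∧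
    ∃ φ : ℕ → 𝓓(Ω, ℝ), ∀ i ≤ l, ∀ s : Fin i → Fin n,
      Filter.Tendsto (fun m => toL2 Ω (partialDeriv s (φ m))) Filter.atTop (nhds (g i s))

/-- The polyharmonic operator `(-Δ)^l` on test functions. -/
def polyLaplacian (Ω : Opens (EuclideanSpace ℝ (Fin n))) (l : ℕ) : 𝓓(Ω, ℝ) → 𝓓(Ω, ℝ) :=
  (fun φ => -LineDeriv.laplacianCLM ℝ (EuclideanSpace ℝ (Fin n)) 𝓓(Ω, ℝ) φ)^[l]

/-- The space of weak solutions of the Dirichlet problem for `(-Δ)^l u = μ u` on `Ω`: all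
`u ∈ H_0^l(Ω)` (this encodes `u = ∂u/∂ν = ⋯ = ∂^{l-1}u/∂ν^{l-1} = 0` on the boundary) such that
`∫_Ω u (-Δ)^l φ = μ ∫_Ω u φ` for all test functions `φ`. -/
def eigenspace (Ω : Opens (EuclideanSpace ℝ (Fin n))) (l : ℕ) (μ : ℝ) :
    Submodule ℝ (L2 Ω) where
  carrier := {u | MemSobolevZero Ω l u ∧ ∀ φ : 𝓓(Ω, ℝ),
    inner ℝ u (toL2 Ω (polyLaplacian Ω l φ)) = μ * inner ℝ u (toL2 Ω φ)}
  zero_mem' := by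
    refine ⟨⟨fun _ _ => 0, fun i _ s φ => by simp, fun _ => 0, fun i _ s => ?_⟩,
      fun φ => by simp⟩
    simp [partialDeriv, LineDeriv.iteratedLineDerivOp_zero]
  add_mem' := by
    rintro u v ⟨⟨g, hg, φ, hφ⟩, hu⟩ ⟨⟨h, hh, ψ, hψ⟩, hv⟩
    refine ⟨⟨fun i s => g i s + h i s, fun i hi s χ => ?_, fun m => φ m + ψ m,
      fun i hi s => ?_⟩, fun χ => ?_⟩
    · rw [inner_add_left, inner_add_left, hg i hi s χ, hh i hi s χ, mul_add]
    · simpa [partialDeriv, LineDeriv.iteratedLineDerivOp_add] using (hφ i hi s).add (hψ i hi s)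
    · rw [inner_add_left, inner_add_left, hu χ, hv χ, mul_add]
  smul_mem' := by
    rintro c u ⟨⟨g, hg, φ, hφ⟩, hu⟩
    refine ⟨⟨fun i s => c • g i s, fun i hi s χ => ?_, fun m => c • φ m,
      fun i hi s => ?_⟩, fun χ => ?_⟩
    · rw [real_inner_smul_left, real_inner_smul_left, hg i hi s χ, mul_left_comm]
    · simpa [partialDeriv, LineDeriv.iteratedLineDerivOp_smul] using (hφ i hi s).const_smul c
    · rw [real_inner_smul_left, real_inner_smul_left, hu χ, mul_left_comm]

/-- `ev 0 ≤ ev 1 ≤ ⋯` is the list of all eigenvalues of the Dirichlet problem for `(-Δ)^l` on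
`Ω`, each one repeated according to its multiplicity, that is, the dimension of its eigenspace
(a real number that is not an eigenvalue has multiplicity `0` and does not occur). -/
structure IsEigenvalueList (Ω : Opens (EuclideanSpace ℝ (Fin n))) (l : ℕ) (ev : ℕ → ℝ) :
    Prop where
  monotone : Monotone ev
  multiplicity : ∀ μ : ℝ,
    {j : ℕ | ev j = μ}.encard = Cardinal.toENat (Module.rank ℝ (eigenspace Ω l μ))

end Polyharmonic

end

/-
Let `û` be the Fourier transform of `u ∈ L²(Ω)`, extended by zero. If `u` is a normalized
eigenfunction for the eigenvalue `μ`, then `‖û‖²` is a probability density whose moment of order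
`2l` is `μ / (2π)^(2l)`; in particular `μ > 0`. By Jensen's inequality for `t ↦ t ^ (-p)`, the
number `(μ / (2π)^(2l)) ^ (-p)` is at most the moment of order `-2lp`, which is finite since
`2lp < n`. For orthonormal eigenfunctions `u_1, …, u_k`, Bessel's inequality for the plane waves
gives `∑ ‖û_j‖² ≤ |Ω|` pointwise, so `∑ ‖û_j‖²` is a density of mass `k` bounded by `|Ω|`, and its
moment of order `-2lp` is at most that of the density equal to `|Ω|` on a centred ball.
-/

section WeightedIntegrals

open Real

variable {α : Type*} [MeasurableSpace α] {μ : Measure α} {w F : α → ℝ}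

theorem integral_mul_pos (hw : ∀ᵐ x ∂μ, 0 < w x) (hF : 0 ≤ᵐ[μ] F) (hF0 : ∫ x, F x ∂μ ≠ 0)
    (hwF : Integrable (fun x => w x * F x) μ) : 0 < ∫ x, w x * F x ∂μ := by
  have hnonneg : 0 ≤ᵐ[μ] fun x => w x * F x := by
    filter_upwards [hw, hF] with x hwx hFx using mul_nonneg hwx.le hFx
  refine (integral_nonneg_of_ae hnonneg).lt_of_ne' fun h => hF0 (integral_eq_zero_of_ae ?_)
  filter_upwards [(integral_eq_zero_iff_of_nonneg_ae hnonneg hwF).1 h, hw] with x hx hwx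
  exact (mul_eq_zero.1 hx).resolve_left hwx.ne'

theorem one_add_mul_one_sub_le_rpow_neg {t p : ℝ} (ht : 0 < t) (hp : 0 ≤ p) :
    1 + p * (1 - t) ≤ t ^ (-p) := by
  rw [rpow_def_of_pos ht]
  linarith [add_one_le_exp (log t * -p),
    mul_le_mul_of_nonneg_left (log_le_sub_one_of_pos ht) hp]

-- Jensen's inequality for the convex function `t ↦ t ^ (-p)` and the probability density `F`:
-- integrate the tangent line inequality at the mean of `w`.
theorem integral_mul_rpow_neg_le {p : ℝ} (hp : 0 ≤ p) (hw : ∀ᵐ x ∂μ, 0 < w x)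
    (hF : 0 ≤ᵐ[μ] F) (hF1 : ∫ x, F x ∂μ = 1) (hwF : Integrable (fun x => w x * F x) μ)
    (hwpF : Integrable (fun x => w x ^ (-p) * F x) μ) :
    (∫ x, w x * F x ∂μ) ^ (-p) ≤ ∫ x, w x ^ (-p) * F x ∂μ := by
  set a := ∫ x, w x * F x ∂μ with ha
  have ha0 : 0 < a := integral_mul_pos hw hF (by simp [hF1]) hwF
  have hFi : Integrable F μ := .of_integral_ne_zero (by simp [hF1])
  have htangent : ∀ᵐ x ∂μ,
      a ^ (-p) * ((1 + p) * F x - p / a * (w x * F x)) ≤ w x ^ (-p) * F x := by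
    filter_upwards [hw, hF] with x hwx hFx
    calc a ^ (-p) * ((1 + p) * F x - p / a * (w x * F x))
        = a ^ (-p) * (1 + p * (1 - w x / a)) * F x := by ring
      _ ≤ a ^ (-p) * (w x / a) ^ (-p) * F x := by
        gcongr
        exact one_add_mul_one_sub_le_rpow_neg (by positivity) hp
      _ = w x ^ (-p) * F x := by
        rw [← mul_rpow ha0.le (by positivity), mul_div_cancel₀ _ ha0.ne']
  calc a ^ (-p) = ∫ x, a ^ (-p) * ((1 + p) * F x - p / a * (w x * F x)) ∂μ := by
        rw [integral_const_mul, integral_sub (hFi.const_mul _) (hwF.const_mul _),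
          integral_const_mul, integral_const_mul, hF1, ← ha, div_mul_cancel₀ _ ha0.ne']
        ring
    _ ≤ ∫ x, w x ^ (-p) * F x ∂μ :=
      integral_mono_ae (((hFi.const_mul _).sub (hwF.const_mul _)).const_mul _) hwpF htangent

variable {S : Set α} {c M : ℝ}

theorem integrable_mul_of_integrableOn_of_bounded_compl (hS : MeasurableSet S)
    (hw : AEStronglyMeasurable w μ) (hwS : IntegrableOn w S μ)
    (hwSc : ∀ᵐ x ∂μ, x ∉ S → ‖w x‖ ≤ c) (hF : Integrable F μ) (hFM : ∀ᵐ x ∂μ, ‖F x‖ ≤ M) :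
    Integrable (fun x => w x * F x) μ := by
  have hin : IntegrableOn (fun x => w x * F x) S μ :=
    hwS.mul_bdd (c := M) hF.aestronglyMeasurable.restrict (ae_restrict_of_ae hFM)
  have hout : IntegrableOn (fun x => w x * F x) Sᶜ μ :=
    hF.restrict.bdd_mul (c := c) hw.restrict ((ae_restrict_iff' hS.compl).2 hwSc)
  exact integrableOn_univ.1 (S.union_compl_self ▸ hin.union hout)

-- The bathtub principle: among all `0 ≤ F ≤ M` of given mass, `M` times the indicator of the
-- superlevel set `S` of `w` maximizes the integral.
theorem integral_mul_le_of_superlevel (hS : MeasurableSet S) (hμS : μ S ≠ ⊤)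
    (hwS : ∀ᵐ x ∂μ, x ∈ S → c ≤ w x) (hwSc : ∀ᵐ x ∂μ, x ∉ S → w x ≤ c)
    (hwi : IntegrableOn w S μ) (hF0 : 0 ≤ᵐ[μ] F) (hFM : ∀ᵐ x ∂μ, F x ≤ M)
    (hF : Integrable F μ) (hwF : Integrable (fun x => w x * F x) μ)
    (hmass : ∫ x, F x ∂μ = M * μ.real S) :
    ∫ x, w x * F x ∂μ ≤ M * ∫ x in S, w x ∂μ := by
  have hexcess : Integrable (S.indicator fun x => (w x - c) * M) μ :=
    (integrable_indicator_iff hS).2 ((hwi.sub (integrableOn_const hμS)).mul_const M)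
  have hpointwise : ∀ᵐ x ∂μ, w x * F x ≤ c * F x + S.indicator (fun x => (w x - c) * M) x := by
    filter_upwards [hwS, hwSc, hF0, hFM] with x hin hout h0 hM
    by_cases hx : x ∈ S
    · rw [Set.indicator_of_mem hx]
      linarith [mul_le_mul_of_nonneg_left hM (sub_nonneg.2 (hin hx))]
    · rw [Set.indicator_of_notMem hx, add_zero]
      exact mul_le_mul_of_nonneg_right (hout hx) h0
  calc ∫ x, w x * F x ∂μ
      ≤ ∫ x, (c * F x + S.indicator (fun x => (w x - c) * M) x) ∂μ :=
        integral_mono_ae hwF ((hF.const_mul c).add hexcess) hpointwise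
    _ = M * ∫ x in S, w x ∂μ := by
        rw [integral_add (hF.const_mul c) hexcess, integral_const_mul, integral_indicator hS,
          integral_mul_const, integral_sub hwi (integrableOn_const hμS), hmass,
          setIntegral_const, smul_eq_mul]
        ring

end WeightedIntegrals

section PowerWeights

open Module Metric Real

theorem pow_pred_smul_rpow {d : ℕ} (hd : 0 < d) (r : ℝ) {y : ℝ} (hy : 0 < y) :
    y ^ (d - 1) • y ^ r = y ^ (d - 1 + r : ℝ) := by
  rw [smul_eq_mul, ← rpow_natCast, Nat.cast_sub hd, Nat.cast_one, ← rpow_add hy]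

variable {E : Type*} [NormedAddCommGroup E] [NormedSpace ℝ E] [FiniteDimensional ℝ E]
  [Nontrivial E] [MeasurableSpace E] [BorelSpace E] (ν : Measure E) [ν.IsAddHaarMeasure]

theorem addHaar_real_ball_eq_pow_mul {R : ℝ} (hR : 0 ≤ R) :
    ν.real (ball (0 : E) R) = R ^ finrank ℝ E * ν.real (ball (0 : E) 1) := by
  rw [measureReal_def, Measure.addHaar_ball ν 0 hR, ENNReal.toReal_mul,
    ENNReal.toReal_ofReal (by positivity), measureReal_def]

theorem integrableOn_ball_norm_rpow {r : ℝ} (hr : -finrank ℝ E < r) (R : ℝ) :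
    IntegrableOn (fun x : E => ‖x‖ ^ r) (ball 0 R) ν := by
  rw [integrableOn_fun_norm_addHaar ν (f := fun y => y ^ r)]
  rcases le_or_gt R 0 with hR | hR
  · simp [Set.Ioo_eq_empty_of_le hR]
  refine ((intervalIntegral.integrableOn_Ioo_rpow_iff hR).2 ?_).congr_fun
    (fun y hy => (pow_pred_smul_rpow finrank_pos r hy.1).symm) measurableSet_Ioo
  linarith

theorem integral_ball_norm_rpow {r R : ℝ} (hr : -finrank ℝ E < r) (hR : 0 < R) :
    ∫ x in ball (0 : E) R, ‖x‖ ^ r ∂ν =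
      finrank ℝ E / (finrank ℝ E + r) * R ^ r * ν.real (ball (0 : E) R) := by
  have hne : (finrank ℝ E : ℝ) + r ≠ 0 := by linarith
  have hradial : ∫ y in Set.Ioi (0 : ℝ), y ^ (finrank ℝ E - 1) •
      (Set.Iio R).indicator (fun y => y ^ r) y = R ^ (finrank ℝ E + r) / (finrank ℝ E + r) := by
    calc _ = ∫ y in Set.Ioi (0 : ℝ),
            (Set.Iio R).indicator (fun y => y ^ (finrank ℝ E - 1 + r : ℝ)) y := by
          refine setIntegral_congr_fun measurableSet_Ioi fun y hy => ?_
          by_cases hyR : y < R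
          · simpa [Set.indicator, hyR] using pow_pred_smul_rpow (finrank_pos (R := ℝ) (M := E)) r hy
          · simp [Set.indicator, hyR]
      _ = ∫ y in 0..R, y ^ (finrank ℝ E - 1 + r : ℝ) := by
          rw [setIntegral_indicator measurableSet_Iio, Set.Ioi_inter_Iio,
            ← integral_Ioc_eq_integral_Ioo, intervalIntegral.integral_of_le hR.le]
      _ = R ^ (finrank ℝ E + r) / (finrank ℝ E + r) := by
          rw [integral_rpow (.inl (by linarith)),
            show (finrank ℝ E : ℝ) - 1 + r + 1 = finrank ℝ E + r by ring, zero_rpow hne, sub_zero]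
  calc ∫ x in ball (0 : E) R, ‖x‖ ^ r ∂ν
      = ∫ x : E, (Set.Iio R).indicator (fun y => y ^ r) ‖x‖ ∂ν := by
        rw [← integral_indicator measurableSet_ball]
        congr with x
        simp [Set.indicator]
    _ = finrank ℝ E / (finrank ℝ E + r) * R ^ r * ν.real (ball (0 : E) R) := by
        rw [integral_fun_norm_addHaar ν, hradial, addHaar_real_ball_eq_pow_mul ν hR.le,
          rpow_add hR, rpow_natCast, nsmul_eq_mul, smul_eq_mul]
        ring

variable {ν}

theorem integrable_norm_rpow_mul {r M : ℝ} {F : E → ℝ} (hr : -finrank ℝ E < r) (hr0 : r ≤ 0)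
    (hF : Integrable F ν) (hFM : ∀ᵐ x ∂ν, ‖F x‖ ≤ M) :
    Integrable (fun x => ‖x‖ ^ r * F x) ν := by
  refine integrable_mul_of_integrableOn_of_bounded_compl (S := ball 0 1) (c := 1)
    measurableSet_ball (by fun_prop : Measurable fun x : E => ‖x‖ ^ r).aestronglyMeasurable
    (integrableOn_ball_norm_rpow ν hr 1)
    (.of_forall fun x hx => ?_) hF hFM
  rw [norm_of_nonneg (by positivity)]
  exact rpow_le_one_of_one_le_of_nonpos (by simpa using hx) hr0

theorem integral_norm_rpow_mul_le_of_mass_eq {r M R : ℝ} {F : E → ℝ} (hr : -finrank ℝ E < r)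
    (hr0 : r ≤ 0) (hR : 0 < R) (hF0 : 0 ≤ᵐ[ν] F) (hFM : ∀ᵐ x ∂ν, F x ≤ M)
    (hF : Integrable F ν) (hmass : ∫ x, F x ∂ν = M * ν.real (ball (0 : E) R)) :
    ∫ x, ‖x‖ ^ r * F x ∂ν ≤ finrank ℝ E / (finrank ℝ E + r) * R ^ r * ∫ x, F x ∂ν := by
  have hFM' : ∀ᵐ x ∂ν, ‖F x‖ ≤ M := by
    filter_upwards [hF0, hFM] with x h0 hM using (norm_of_nonneg h0).trans_le hM
  calc ∫ x, ‖x‖ ^ r * F x ∂ν ≤ M * ∫ x in ball (0 : E) R, ‖x‖ ^ r ∂ν := by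
        refine integral_mul_le_of_superlevel (c := R ^ r) measurableSet_ball
          measure_ball_lt_top.ne ?_ ?_ (integrableOn_ball_norm_rpow ν hr R) hF0 hFM hF
          (integrable_norm_rpow_mul hr hr0 hF hFM') hmass
        · filter_upwards [Measure.ae_ne ν (0 : E)] with x hx hxR
          exact rpow_le_rpow_of_nonpos (norm_pos_iff.2 hx) (mem_ball_zero_iff.1 hxR).le hr0
        · refine .of_forall fun x hxR => rpow_le_rpow_of_nonpos hR ?_ hr0
          simpa using hxR
    _ = finrank ℝ E / (finrank ℝ E + r) * R ^ r * ∫ x, F x ∂ν := by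
        rw [integral_ball_norm_rpow ν hr hR, hmass]
        ring

variable (ν) in
theorem exists_pos_radius_mass_eq {m M : ℝ} (hm : 0 < m) (hM : 0 < M) :
    ∃ R, 0 < R ∧ m = M * ν.real (ball (0 : E) R) ∧ ∀ a : ℝ, R ^ (-a) * m =
      (M * ν.real (ball (0 : E) 1)) ^ (a / finrank ℝ E) * m ^ (1 - a / finrank ℝ E) := by
  have hω : 0 < ν.real (ball (0 : E) 1) :=
    ENNReal.toReal_pos (measure_ball_pos ν 0 one_pos).ne' measure_ball_lt_top.ne
  set B := M * ν.real (ball (0 : E) 1) with hB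
  have hB0 : 0 < B := mul_pos hM hω
  refine ⟨(m / B) ^ (finrank ℝ E : ℝ)⁻¹, by positivity, ?_, fun a => ?_⟩
  · rw [addHaar_real_ball_eq_pow_mul ν (by positivity), rpow_inv_natCast_pow (by positivity)
      finrank_pos.ne', mul_left_comm, ← hB, div_mul_cancel₀ _ hB0.ne']
  · rw [← rpow_mul (by positivity), mul_neg, inv_mul_eq_div, rpow_neg (by positivity),
      ← inv_rpow (by positivity), inv_div, div_rpow hB0.le hm.le, rpow_sub hm, rpow_one]
    ring

theorem integral_norm_rpow_neg_mul_le {a M : ℝ} {F : E → ℝ} (ha : 0 ≤ a) (had : a < finrank ℝ E)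
    (hF0 : 0 ≤ᵐ[ν] F) (hFM : ∀ᵐ x ∂ν, F x ≤ M) (hF : Integrable F ν) :
    ∫ x, ‖x‖ ^ (-a) * F x ∂ν ≤ finrank ℝ E / (finrank ℝ E - a) *
      (M * ν.real (ball (0 : E) 1)) ^ (a / finrank ℝ E) *
        (∫ x, F x ∂ν) ^ (1 - a / finrank ℝ E) := by
  have hd : (0 : ℝ) < finrank ℝ E := by exact_mod_cast finrank_pos
  have hM0 : 0 ≤ M := by
    obtain ⟨x, h0, hM⟩ := (hF0.and hFM).exists
    exact h0.trans hM
  rcases (integral_nonneg_of_ae hF0).eq_or_lt with hmass0 | hmass0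
  · have hF_zero := (integral_eq_zero_iff_of_nonneg_ae hF0 hF).1 hmass0.symm
    have hlhs : ∫ x, ‖x‖ ^ (-a) * F x ∂ν = 0 :=
      integral_eq_zero_of_ae (by filter_upwards [hF_zero] with x hx; simp [hx])
    have := sub_pos.2 had
    rw [hlhs, ← hmass0]
    positivity
  have hM : 0 < M := hM0.lt_of_ne fun h => hmass0.ne' <| integral_eq_zero_of_ae <| by
    filter_upwards [hF0, hFM] with x h0 hM using le_antisymm (hM.trans h.ge) h0
  obtain ⟨R, hR0, hball, hRpow⟩ := exists_pos_radius_mass_eq ν hmass0 hM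
  calc ∫ x, ‖x‖ ^ (-a) * F x ∂ν
      ≤ finrank ℝ E / (finrank ℝ E + -a) * R ^ (-a) * ∫ x, F x ∂ν :=
        integral_norm_rpow_mul_le_of_mass_eq (by linarith) (by linarith) hR0 hF0 hFM hF hball
    _ = _ := by rw [mul_assoc, hRpow, ← sub_eq_add_neg, ← mul_assoc]

theorem sum_integral_norm_rpow_mul_rpow_neg_le {ι : Type*} [Fintype ι] {b p M : ℝ} (hb : 0 ≤ b)
    (hp : 0 ≤ p) (hbp : b * p < finrank ℝ E) {F : ι → E → ℝ} (hF0 : ∀ j, 0 ≤ᵐ[ν] F j)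
    (hF1 : ∀ j, ∫ x, F j x ∂ν = 1) (hbF : ∀ j, Integrable (fun x => ‖x‖ ^ b * F j x) ν)
    (hFM : ∀ᵐ x ∂ν, ∑ j, F j x ≤ M) :
    ∑ j, (∫ x, ‖x‖ ^ b * F j x ∂ν) ^ (-p) ≤ finrank ℝ E / (finrank ℝ E - b * p) *
      (M * ν.real (ball (0 : E) 1)) ^ (b * p / finrank ℝ E) *
        (Fintype.card ι : ℝ) ^ (1 - b * p / finrank ℝ E) := by
  have hF (j) : Integrable (F j) ν := .of_integral_ne_zero (by simp [hF1])
  have hF0' : ∀ᵐ x ∂ν, ∀ j, 0 ≤ F j x := ae_all_iff.2 hF0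
  have hFjM (j) : ∀ᵐ x ∂ν, ‖F j x‖ ≤ M := by
    filter_upwards [hF0', hFM] with x h0 hM
    rw [norm_of_nonneg (h0 j)]
    exact (Finset.single_le_sum (fun i _ => h0 i) (Finset.mem_univ j)).trans hM
  have hpow (x : E) : (‖x‖ ^ b) ^ (-p) = ‖x‖ ^ (-(b * p)) := by
    rw [← rpow_mul (norm_nonneg x), mul_neg]
  have hint (j) : Integrable (fun x => ‖x‖ ^ (-(b * p)) * F j x) ν :=
    integrable_norm_rpow_mul (by linarith) (by simp [mul_nonneg hb hp]) (hF j) (hFjM j)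
  calc ∑ j, (∫ x, ‖x‖ ^ b * F j x ∂ν) ^ (-p)
      ≤ ∑ j, ∫ x, (‖x‖ ^ b) ^ (-p) * F j x ∂ν := by
        refine Finset.sum_le_sum fun j _ => integral_mul_rpow_neg_le hp ?_ (hF0 j) (hF1 j)
          (hbF j) (by simpa only [hpow] using hint j)
        filter_upwards [Measure.ae_ne ν (0 : E)] with x hx
        positivity
    _ = ∫ x, ‖x‖ ^ (-(b * p)) * ∑ j, F j x ∂ν := by
        simp only [hpow, Finset.mul_sum]
        exact (integral_finsetSum _ fun j _ => hint j).symm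
    _ ≤ _ := by
        have hmass : ∫ x, ∑ j, F j x ∂ν = Fintype.card ι := by
          rw [integral_finsetSum _ fun j _ => hF j]
          simp [hF1]
        rw [← hmass]
        refine integral_norm_rpow_neg_mul_le (mul_nonneg hb hp) hbp ?_ hFM
          (integrable_finsetSum _ fun j _ => hF j)
        filter_upwards [hF0'] with x h0 using Finset.sum_nonneg fun j _ => h0 j

end PowerWeights

section FourierOnSet

open Real
open scoped FourierTransform SchwartzMap ContDiff

variable {V : Type*} [NormedAddCommGroup V] [InnerProductSpace ℝ V] [FiniteDimensional ℝ V]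
  [MeasurableSpace V] [BorelSpace V]

theorem integral_fourier_smul_eq {f g : V → ℂ} (hf : Integrable f) (hg : Integrable g) :
    ∫ ξ, 𝓕 f ξ • g ξ = ∫ x, f x • 𝓕 g x := by
  have h := VectorFourier.integral_fourierIntegral_smul_eq_flip (L := innerₗ V) (μ := volume)
    (ν := volume) continuous_fourierChar continuous_inner hf hg
  rwa [flip_innerₗ] at h

theorem fourier_toLp_ae_eq {f : V → ℂ} (hf : Integrable f) (hf2 : MemLp f 2) :
    (𝓕 (hf2.toLp f) : Lp ℂ 2 (volume : Measure V)) =ᵐ[volume] 𝓕 f := by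
  refine ae_eq_of_integral_contDiff_smul_eq
    ((Lp.memLp (𝓕 (hf2.toLp f))).locallyIntegrable (by norm_num))
    (VectorFourier.fourierIntegral_continuous continuous_fourierChar continuous_inner
      hf).locallyIntegrable fun g hg hgc => ?_
  let ψ : 𝓢(V, ℂ) := (hgc.comp_left Complex.ofReal_zero).toSchwartzMap
    (Complex.ofRealCLM.contDiff.comp hg)
  have hψ (h : V → ℂ) (x : V) : g x • h x = ψ x • h x := (Complex.coe_smul (g x) (h x)).symm
  simp only [hψ]
  calc ∫ x, ψ x • 𝓕 (hf2.toLp f) x = ∫ x, 𝓕 ψ x • hf2.toLp f x := by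
        rw [← Lp.toTemperedDistribution_apply, ← Lp.fourier_toTemperedDistribution_eq,
          TemperedDistribution.fourier_apply, Lp.toTemperedDistribution_apply]
    _ = ∫ x, 𝓕 (ψ : V → ℂ) x • f x := by
        refine integral_congr_ae ?_
        filter_upwards [hf2.coeFn_toLp] with x hx
        rw [hx, SchwartzMap.fourier_coe]
    _ = ∫ x, ψ x • 𝓕 f x := integral_fourier_smul_eq ψ.integrable hf

theorem integrable_norm_sq_coeFn_and_integral_eq {α : Type*} [MeasurableSpace α] {μ : Measure α}
    (f : Lp ℂ 2 μ) : Integrable (fun x => ‖f x‖ ^ 2) μ ∧ ∫ x, ‖f x‖ ^ 2 ∂μ = ‖f‖ ^ 2 := by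
  refine ⟨(Lp.memLp f).integrable_norm_pow (by simp), ?_⟩
  rw [← inner_self_eq_norm_sq (𝕜 := ℂ), L2.inner_def, ← integral_re (L2.integrable_inner _ _)]
  simp only [inner_self_eq_norm_sq (𝕜 := ℂ)]

variable {s : Set V}

/-- The Fourier transform of a function in `L²(s)`, extended by zero outside `s`. -/
noncomputable def fourierOn (f : Lp ℂ 2 (volume.restrict s)) : V → ℂ :=
  𝓕 (s.indicator f)

variable [IsFiniteMeasure (volume.restrict s)]

theorem plancherel_fourierOn (hs : MeasurableSet s) (f : Lp ℂ 2 (volume.restrict s)) :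
    Integrable (fun ξ => ‖fourierOn f ξ‖ ^ 2) ∧ ∫ ξ, ‖fourierOn f ξ‖ ^ 2 = ‖f‖ ^ 2 := by
  have hf2 : MemLp (s.indicator f) 2 := (memLp_indicator_iff_restrict hs).2 (Lp.memLp f)
  have hf : Integrable (s.indicator f) :=
    (integrable_indicator_iff hs).2 ((Lp.memLp f).integrable (by norm_num))
  have hae : (fun ξ => ‖(𝓕 (hf2.toLp _) : Lp ℂ 2 (volume : Measure V)) ξ‖ ^ 2) =ᵐ[volume]
      fun ξ => ‖fourierOn f ξ‖ ^ 2 := by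
    filter_upwards [fourier_toLp_ae_eq hf hf2] with ξ hξ
    rw [hξ, fourierOn]
  obtain ⟨hint, heq⟩ := integrable_norm_sq_coeFn_and_integral_eq (𝓕 (hf2.toLp _))
  refine ⟨hint.congr hae, ?_⟩
  rw [← integral_congr_ae hae, heq, Lp.norm_fourier_eq, Lp.norm_toLp, Lp.norm_def,
    eLpNorm_indicator_eq_eLpNorm_restrict hs]

variable (s) in
/-- The plane wave `x ↦ exp (2πi x·ξ)` in `L²(s)`, which represents the value of `fourierOn` at
the frequency `ξ`. -/
noncomputable def planeWave (ξ : V) : Lp ℂ 2 (volume.restrict s) :=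
  (MemLp.of_bound (f := fun x : V => Complex.exp (↑(2 * π * inner ℝ x ξ) * Complex.I))
    (by fun_prop) 1 (.of_forall fun x => (Complex.norm_exp_ofReal_mul_I _).le)).toLp _

theorem planeWave_ae_eq (ξ : V) :
    planeWave s ξ =ᵐ[volume.restrict s]
      fun x => Complex.exp (↑(2 * π * inner ℝ x ξ) * Complex.I) :=
  MemLp.coeFn_toLp _

theorem norm_planeWave_sq (ξ : V) : ‖planeWave s ξ‖ ^ 2 = volume.real s := by
  rw [← (integrable_norm_sq_coeFn_and_integral_eq _).2]
  calc ∫ x in s, ‖planeWave s ξ x‖ ^ 2 = ∫ _ in s, (1 : ℝ) := by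
        refine integral_congr_ae ?_
        filter_upwards [planeWave_ae_eq ξ] with x hx
        rw [hx, Complex.norm_exp_ofReal_mul_I, one_pow]
    _ = volume.real s := by simp

theorem fourierOn_eq_inner (hs : MeasurableSet s) (f : Lp ℂ 2 (volume.restrict s)) (ξ : V) :
    fourierOn f ξ = inner ℂ (planeWave s ξ) f := by
  calc fourierOn f ξ
      = ∫ x, s.indicator (fun x => Complex.exp (↑(-2 * π * inner ℝ x ξ) * Complex.I) * f x) x := by
        rw [fourierOn, Real.fourier_eq']
        simp only [smul_eq_mul, Set.indicator_mul_right]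
    _ = ∫ x in s, inner ℂ (planeWave s ξ x) (f x) := by
        rw [integral_indicator hs]
        refine integral_congr_ae ?_
        filter_upwards [planeWave_ae_eq ξ] with x hx
        rw [hx, RCLike.inner_apply', ← Complex.exp_conj, map_mul, Complex.conj_ofReal,
          Complex.conj_I]
        simp
    _ = inner ℂ (planeWave s ξ) f := (L2.inner_def _ _).symm

theorem continuous_fourierOn_apply (hs : MeasurableSet s) (ξ : V) :
    Continuous fun f : Lp ℂ 2 (volume.restrict s) => fourierOn f ξ := by
  simp only [fourierOn_eq_inner hs]
  fun_prop

theorem sum_norm_fourierOn_sq_le {ι : Type*} [Fintype ι] (hs : MeasurableSet s)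
    {f : ι → Lp ℂ 2 (volume.restrict s)} (hf : Orthonormal ℂ f) (ξ : V) :
    ∑ j, ‖fourierOn (f j) ξ‖ ^ 2 ≤ volume.real s := by
  simp only [fourierOn_eq_inner hs, norm_inner_symm (planeWave s ξ)]
  exact (hf.sum_inner_products_le _).trans_eq (norm_planeWave_sq ξ)

end FourierOnSet

section Complexification

variable {α : Type*} [MeasurableSpace α] {μ : Measure α}

variable (μ) in
/-- The inclusion of the real Hilbert space `L²(μ)` in the complex one. -/
noncomputable def complexify : Lp ℝ 2 μ →L[ℝ] Lp ℂ 2 μ :=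
  Complex.ofRealCLM.compLpL 2 μ

theorem complexify_ae_eq (u : Lp ℝ 2 μ) : complexify μ u =ᵐ[μ] fun x => (u x : ℂ) :=
  Complex.ofRealCLM.coeFn_compLpL u

theorem inner_complexify (u v : Lp ℝ 2 μ) :
    inner ℂ (complexify μ u) (complexify μ v) = (inner ℝ u v : ℂ) := by
  rw [L2.inner_def, L2.inner_def, ← integral_complex_ofReal]
  refine integral_congr_ae ?_
  filter_upwards [complexify_ae_eq u, complexify_ae_eq v] with x hu hv
  simp [hu, hv]

theorem norm_complexify (u : Lp ℝ 2 μ) : ‖complexify μ u‖ = ‖u‖ := by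
  have hsq : ‖complexify μ u‖ ^ 2 = ‖u‖ ^ 2 := by
    rw [← inner_self_eq_norm_sq (𝕜 := ℂ), inner_complexify, ← real_inner_self_eq_norm_sq]
    rfl
  exact (sq_eq_sq₀ (norm_nonneg _) (norm_nonneg _)).1 hsq

theorem orthonormal_complexify {ι : Type*} {u : ι → Lp ℝ 2 μ} (hu : Orthonormal ℝ u) :
    Orthonormal ℂ fun j => complexify μ (u j) := by
  classical
  rw [orthonormal_iff_ite] at hu ⊢
  intro i j
  rw [inner_complexify, hu]
  split_ifs <;> simp

end Complexification

section OrthonormalSelection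

variable {𝕜 E ι κ : Type*} [RCLike 𝕜] [NormedAddCommGroup E] [InnerProductSpace 𝕜 E]

theorem exists_orthonormal_of_card_le_rank [Fintype ι]
    (h : (Fintype.card ι : Cardinal) ≤ Module.rank 𝕜 E) : ∃ v : ι → E, Orthonormal 𝕜 v := by
  obtain ⟨w, hw⟩ := Module.le_rank_iff.1 h
  exact ⟨InnerProductSpace.gramSchmidtNormed 𝕜 w ∘ Fintype.equivFin ι,
    (InnerProductSpace.gramSchmidtNormed_orthonormal hw).comp _ (Fintype.equivFin ι).injective⟩

theorem exists_orthonormal_mem_of_card_fiber_le_rank [Finite ι] {V : κ → Submodule 𝕜 E}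
    (hV : Pairwise fun c d => V c ⟂ V d) (f : ι → κ)
    (hf : ∀ c, (Nat.card {i // f i = c} : Cardinal) ≤ Module.rank 𝕜 (V c)) :
    ∃ u : ι → E, Orthonormal 𝕜 u ∧ ∀ i, u i ∈ V (f i) := by
  have := Fintype.ofFinite ι
  classical
  have hfiber (c) : ∃ v : {i // f i = c} → V c, Orthonormal 𝕜 v :=
    exists_orthonormal_of_card_le_rank (by simpa using hf c)
  choose v hv using hfiber
  have hsigma := (OrthogonalFamily.of_pairwise hV).orthonormal_sigma_orthonormal hv
  exact ⟨_, hsigma.comp (fun i => ⟨f i, i, rfl⟩) fun i j hij =>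
    congrArg (fun a : Σ c, {i // f i = c} => (a.2 : ι)) hij,
    fun i => (v (f i) ⟨i, rfl⟩).2⟩

end OrthonormalSelection

namespace Polyharmonic

open Real Module
open scoped FourierTransform SchwartzMap ContDiff

variable {n : ℕ} {Ω : Opens (EuclideanSpace ℝ (Fin n))}

/-- A real test function, extended by zero and regarded as a complex Schwartz function. -/
noncomputable def toSchwartz (φ : 𝓓(Ω, ℝ)) : 𝓢(EuclideanSpace ℝ (Fin n), ℂ) :=
  HasCompactSupport.toSchwartzMap (f := fun x => (φ x : ℂ))
    (φ.hasCompactSupport.comp_left Complex.ofReal_zero) (Complex.ofRealCLM.contDiff.comp φ.contDiff)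

@[simp]
theorem toSchwartz_apply (φ : 𝓓(Ω, ℝ)) (x : EuclideanSpace ℝ (Fin n)) :
    toSchwartz φ x = (φ x : ℂ) := rfl

theorem eq_of_fourier_toSchwartz_eq {φ ψ : 𝓓(Ω, ℝ)}
    (h : ∀ ξ, 𝓕 (toSchwartz φ) ξ = 𝓕 (toSchwartz ψ) ξ) : φ = ψ := by
  have hS : toSchwartz φ = toSchwartz ψ :=
    (FourierTransform.fourierCLE ℂ 𝓢(EuclideanSpace ℝ (Fin n), ℂ)).injective (SchwartzMap.ext h)
  ext x
  simpa using DFunLike.congr_fun hS x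

theorem lineDerivOp_apply (v : EuclideanSpace ℝ (Fin n)) (φ : 𝓓(Ω, ℝ))
    (x : EuclideanSpace ℝ (Fin n)) : (∂_{v} φ) x = fderiv ℝ φ x v := by
  rw [TestFunction.lineDerivOp_eq_lineDerivCLM (𝕜 := ℝ),
    TestFunction.lineDerivCLM_apply_of_le (by simp),
    (φ.contDiff.differentiable (by simp)).differentiableAt.lineDeriv_eq_fderiv]

theorem toSchwartz_lineDerivOp (v : EuclideanSpace ℝ (Fin n)) (φ : 𝓓(Ω, ℝ)) :
    toSchwartz (∂_{v} φ) = ∂_{v} (toSchwartz φ) := by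
  ext x
  have h : HasFDerivAt (toSchwartz φ) (Complex.ofRealCLM ∘L fderiv ℝ φ x) x :=
    Complex.ofRealCLM.hasFDerivAt.comp x
      (φ.contDiff.differentiable (by simp)).differentiableAt.hasFDerivAt
  rw [SchwartzMap.lineDerivOp_apply_eq_fderiv, toSchwartz_apply, lineDerivOp_apply, h.fderiv]
  rfl

theorem fourier_toSchwartz_lineDerivOp (v : EuclideanSpace ℝ (Fin n)) (φ : 𝓓(Ω, ℝ))
    (ξ : EuclideanSpace ℝ (Fin n)) :
    𝓕 (toSchwartz (∂_{v} φ)) ξ =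
      (2 * π * Complex.I) * (inner ℝ ξ v : ℝ) * 𝓕 (toSchwartz φ) ξ := by
  have hv : (inner ℝ · v).HasTemperateGrowth := ((innerSL ℝ).flip v).hasTemperateGrowth
  rw [toSchwartz_lineDerivOp, SchwartzMap.fourier_lineDerivOp_eq, _root_.smul_apply,
    SchwartzMap.smulLeftCLM_apply_apply hv]
  simp [mul_assoc]

theorem lineDerivOp_comm (v w : EuclideanSpace ℝ (Fin n)) (φ : 𝓓(Ω, ℝ)) :
    ∂_{v} (∂_{w} φ) = ∂_{w} (∂_{v} φ) :=
  eq_of_fourier_toSchwartz_eq fun ξ => by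
    simp only [fourier_toSchwartz_lineDerivOp]
    ring

theorem partialDeriv_cons {i : ℕ} (a : Fin n) (s : Fin i → Fin n) (φ : 𝓓(Ω, ℝ)) :
    partialDeriv (Fin.cons a s) φ =
      ∂_{EuclideanSpace.single a (1 : ℝ)} (partialDeriv s φ) := rfl

theorem partialDeriv_lineDerivOp {i : ℕ} (v : EuclideanSpace ℝ (Fin n)) (s : Fin i → Fin n)
    (φ : 𝓓(Ω, ℝ)) : partialDeriv s (∂_{v} φ) = ∂_{v} (partialDeriv s φ) := by
  induction s using Fin.consInduction with
  | elim0 => rfl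
  | cons a s ih => rw [partialDeriv_cons, partialDeriv_cons, ih, lineDerivOp_comm]

theorem fourier_toSchwartz_partialDeriv {i : ℕ} (s : Fin i → Fin n) (φ : 𝓓(Ω, ℝ))
    (ξ : EuclideanSpace ℝ (Fin n)) :
    𝓕 (toSchwartz (partialDeriv s φ)) ξ =
      (∏ j, (2 * π * Complex.I) * (ξ (s j) : ℂ)) * 𝓕 (toSchwartz φ) ξ := by
  induction s using Fin.consInduction with
  | elim0 => simp [partialDeriv]
  | cons a s ih =>
    rw [partialDeriv_cons, fourier_toSchwartz_lineDerivOp, ih, Fin.prod_univ_succ,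
      EuclideanSpace.inner_single_right]
    simp [mul_assoc]

theorem polyLaplacian_succ (l : ℕ) (φ : 𝓓(Ω, ℝ)) :
    polyLaplacian Ω (l + 1) φ =
      -LineDeriv.laplacianCLM ℝ (EuclideanSpace ℝ (Fin n)) 𝓓(Ω, ℝ) (polyLaplacian Ω l φ) :=
  Function.iterate_succ_apply' _ _ _

theorem polyLaplacian_eq_sum (l : ℕ) (φ : 𝓓(Ω, ℝ)) :
    polyLaplacian Ω l φ =
      (-1 : ℝ) ^ l • ∑ s : Fin l → Fin n, partialDeriv s (partialDeriv s φ) := by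
  induction l with
  | zero => simp [polyLaplacian, partialDeriv]
  | succ l ih =>
    rw [polyLaplacian_succ, ih, map_smul, map_sum, pow_succ, mul_neg_one, neg_smul]
    congr 2
    rw [← (Fin.consEquiv fun _ : Fin (l + 1) => Fin n).sum_comp, Fintype.sum_prod_type,
      Finset.sum_comm]
    refine Finset.sum_congr rfl fun s _ => ?_
    rw [LineDeriv.laplacianCLM_eq_sum (EuclideanSpace.basisFun (Fin n) ℝ)]
    refine Finset.sum_congr rfl fun a _ => ?_
    simp only [Fin.consEquiv, Equiv.coe_fn_mk, EuclideanSpace.basisFun_apply]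
    rw [partialDeriv_cons, partialDeriv_cons, partialDeriv_lineDerivOp]

theorem inner_toL2_polyLaplacian {l : ℕ} {u : L2 Ω} {g : (Fin l → Fin n) → L2 Ω}
    (hg : ∀ s, HasWeakDeriv s u (g s)) (φ : 𝓓(Ω, ℝ)) :
    inner ℝ u (toL2 Ω (polyLaplacian Ω l φ)) =
      ∑ s, inner ℝ (g s) (toL2 Ω (partialDeriv s φ)) := by
  rw [polyLaplacian_eq_sum, map_smul, map_sum, real_inner_smul_right, inner_sum, Finset.mul_sum]
  refine Finset.sum_congr rfl fun s _ => ?_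
  rw [hg s, ← mul_assoc, ← mul_pow]
  simp

theorem toL2_ae_eq (φ : 𝓓(Ω, ℝ)) : toL2 Ω φ =ᵐ[volume.restrict Ω] φ :=
  (φ.continuous.memLp_of_hasCompactSupport φ.hasCompactSupport :
    MemLp φ 2 (volume.restrict Ω)).coeFn_toLp

theorem inner_toL2 (w : L2 Ω) (φ : 𝓓(Ω, ℝ)) : inner ℝ w (toL2 Ω φ) = ∫ x, φ x * w x := by
  calc inner ℝ w (toL2 Ω φ) = ∫ x in Ω, φ x * w x := by
        rw [L2.inner_def]
        refine integral_congr_ae ?_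
        filter_upwards [toL2_ae_eq φ] with x hx
        simp [hx]
    _ = ∫ x, φ x * w x := by
        refine setIntegral_eq_integral_of_forall_compl_eq_zero fun x hx => ?_
        rw [image_eq_zero_of_notMem_tsupport fun h => hx (φ.tsupport_subset h), zero_mul]

theorem eq_zero_of_forall_inner_toL2_eq_zero {w : L2 Ω}
    (h : ∀ φ : 𝓓(Ω, ℝ), inner ℝ w (toL2 Ω φ) = 0) : w = 0 := by
  have hloc : LocallyIntegrableOn w (Ω : Set (EuclideanSpace ℝ (Fin n))) :=
    locallyIntegrableOn_of_locallyIntegrable_restrict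
      ((Lp.memLp w).locallyIntegrable (by norm_num))
  have hzero : ∀ᵐ x, x ∈ (Ω : Set (EuclideanSpace ℝ (Fin n))) → w x = 0 :=
    Ω.isOpen.ae_eq_zero_of_integral_contDiff_smul_eq_zero hloc fun φ hφ hφc hφs =>
      (inner_toL2 w ⟨φ, hφ, hφc, hφs⟩).symm.trans (h _)
  exact (Lp.eq_zero_iff_ae_eq_zero).2 ((ae_restrict_iff' Ω.isOpen.measurableSet).2 hzero)

/-- The function `u` belongs to `H_0^l(Ω)` and `g` is the family of its weak derivatives of the
top order `l`, both in the weak sense and as limits of derivatives of test functions. -/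
structure HasSobolevZeroDeriv {l : ℕ} (u : L2 Ω) (g : (Fin l → Fin n) → L2 Ω) : Prop where
  hasWeakDeriv : ∀ s, HasWeakDeriv s u (g s)
  exists_tendsto : ∃ φ : ℕ → 𝓓(Ω, ℝ),
    Filter.Tendsto (fun m => toL2 Ω (φ m)) Filter.atTop (nhds u) ∧
      ∀ s, Filter.Tendsto (fun m => toL2 Ω (partialDeriv s (φ m))) Filter.atTop (nhds (g s))

theorem MemSobolevZero.exists_hasSobolevZeroDeriv {l : ℕ} {u : L2 Ω} (hu : MemSobolevZero Ω l u) :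
    ∃ g : (Fin l → Fin n) → L2 Ω, HasSobolevZeroDeriv u g := by
  obtain ⟨g, hg, φ, hφ⟩ := hu
  have hu_eq : u = g 0 Fin.elim0 :=
    sub_eq_zero.1 <| eq_zero_of_forall_inner_toL2_eq_zero fun ψ => by
      have h := hg 0 (Nat.zero_le _) Fin.elim0 ψ
      rw [pow_zero, one_mul] at h
      rw [inner_sub_left, sub_eq_zero]
      exact h
  exact ⟨g l, hg l le_rfl, φ, hu_eq ▸ hφ 0 (Nat.zero_le _) Fin.elim0, hφ l le_rfl⟩

theorem mul_inner_eq_sum_inner {l : ℕ} {μ : ℝ} {u v : L2 Ω} {g h : (Fin l → Fin n) → L2 Ω}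
    (hu : u ∈ eigenspace Ω l μ) (hg : HasSobolevZeroDeriv u g) (hh : HasSobolevZeroDeriv v h) :
    μ * inner ℝ u v = ∑ s, inner ℝ (g s) (h s) := by
  obtain ⟨φ, hφ, hφh⟩ := hh.exists_tendsto
  refine tendsto_nhds_unique ((tendsto_const_nhds.inner hφ).const_mul μ)
    ((tendsto_finsetSum Finset.univ fun s _ =>
      tendsto_const_nhds.inner (hφh s)).congr fun m => ?_)
  rw [← inner_toL2_polyLaplacian hg.hasWeakDeriv, hu.2]

theorem pairwise_isOrtho_eigenspace (Ω : Opens (EuclideanSpace ℝ (Fin n))) (l : ℕ) :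
    Pairwise fun μ ν => eigenspace Ω l μ ⟂ eigenspace Ω l ν := by
  intro μ ν hμν
  rw [Submodule.isOrtho_iff_inner_eq]
  intro u hu v hv
  obtain ⟨g, hg⟩ := hu.1.exists_hasSobolevZeroDeriv
  obtain ⟨h, hh⟩ := hv.1.exists_hasSobolevZeroDeriv
  have heq : μ * inner ℝ u v = ν * inner ℝ u v := by
    rw [mul_inner_eq_sum_inner hu hg hh, real_inner_comm, mul_inner_eq_sum_inner hv hh hg]
    simp only [real_inner_comm]
  by_contra hne
  exact hμν (mul_right_cancel₀ hne heq)

theorem IsEigenvalueList.exists_orthonormal {l : ℕ} {ev : ℕ → ℝ} (hev : IsEigenvalueList Ω l ev)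
    (k : ℕ) : ∃ u : Fin k → L2 Ω, Orthonormal ℝ u ∧ ∀ j : Fin k, u j ∈ eigenspace Ω l (ev j) := by
  refine exists_orthonormal_mem_of_card_fiber_le_rank (pairwise_isOrtho_eigenspace Ω l) _
    fun μ => ?_
  have hinj : Function.Injective fun j : {j : Fin k // ev j = μ} =>
      (⟨j.1, j.2⟩ : {j : ℕ | ev j = μ}) := fun a b hab =>
    Subtype.ext (Fin.ext (congrArg (fun j : {j : ℕ | ev j = μ} => (j : ℕ)) hab))
  rw [← Cardinal.natCast_le_toENat, ← hev.multiplicity μ, ← ENat.card_eq_coe_natCard]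
  exact ENat.card_le_card_of_injective hinj

section Fourier

/-- The Fourier transform `ξ ↦ ∫_Ω u(x) exp (-2πi x·ξ) dx` of a real function `u ∈ L²(Ω)`. -/
noncomputable def hat (u : L2 Ω) : EuclideanSpace ℝ (Fin n) → ℂ :=
  fourierOn (complexify _ u)

theorem hat_toL2 (φ : 𝓓(Ω, ℝ)) (ξ : EuclideanSpace ℝ (Fin n)) :
    hat (toL2 Ω φ) ξ = 𝓕 (toSchwartz φ) ξ := by
  have hae : (Ω : Set _).indicator (complexify _ (toL2 Ω φ)) =ᵐ[volume] toSchwartz φ := by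
    filter_upwards [(ae_restrict_iff' Ω.isOpen.measurableSet).1 (toL2_ae_eq φ),
      (ae_restrict_iff' Ω.isOpen.measurableSet).1 (complexify_ae_eq (toL2 Ω φ))] with x hφ hc
    by_cases hx : x ∈ (Ω : Set (EuclideanSpace ℝ (Fin n)))
    · rw [Set.indicator_of_mem hx, hc hx, hφ hx, toSchwartz_apply]
    · rw [Set.indicator_of_notMem hx, toSchwartz_apply,
        image_eq_zero_of_notMem_tsupport fun h => hx (φ.tsupport_subset h), Complex.ofReal_zero]
  rw [hat, fourierOn, SchwartzMap.fourier_coe, Real.fourier_eq', Real.fourier_eq']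
  refine integral_congr_ae ?_
  filter_upwards [hae] with x hx
  rw [hx]

variable [IsFiniteMeasure (volume.restrict (Ω : Set (EuclideanSpace ℝ (Fin n))))]

theorem plancherel_hat (u : L2 Ω) :
    Integrable (fun ξ => ‖hat u ξ‖ ^ 2) ∧ ∫ ξ, ‖hat u ξ‖ ^ 2 = ‖u‖ ^ 2 := by
  rw [← norm_complexify u]
  exact plancherel_fourierOn Ω.isOpen.measurableSet (complexify _ u)

theorem sum_norm_hat_sq_le {ι : Type*} [Fintype ι] {u : ι → L2 Ω} (hu : Orthonormal ℝ u)
    (ξ : EuclideanSpace ℝ (Fin n)) :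
    ∑ j, ‖hat (u j) ξ‖ ^ 2 ≤ volume.real (Ω : Set (EuclideanSpace ℝ (Fin n))) :=
  sum_norm_fourierOn_sq_le Ω.isOpen.measurableSet (orthonormal_complexify hu) ξ

theorem continuous_hat_apply (ξ : EuclideanSpace ℝ (Fin n)) :
    Continuous fun u : L2 Ω => hat u ξ :=
  (continuous_fourierOn_apply Ω.isOpen.measurableSet ξ).comp (complexify _).continuous

theorem HasSobolevZeroDeriv.hat_eq {l : ℕ} {u : L2 Ω} {g : (Fin l → Fin n) → L2 Ω}
    (h : HasSobolevZeroDeriv u g) (s : Fin l → Fin n) (ξ : EuclideanSpace ℝ (Fin n)) :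
    hat (g s) ξ = (∏ j, (2 * π * Complex.I) * (ξ (s j) : ℂ)) * hat u ξ := by
  obtain ⟨φ, hφ, hφg⟩ := h.exists_tendsto
  have hcont := (continuous_hat_apply (Ω := Ω) ξ).tendsto
  refine tendsto_nhds_unique ((hcont _).comp (hφg s))
    ((((hcont _).comp hφ).const_mul _).congr fun m => ?_)
  simp only [Function.comp_apply, hat_toL2, fourier_toSchwartz_partialDeriv]

theorem HasSobolevZeroDeriv.sum_norm_hat_sq {l : ℕ} {u : L2 Ω} {g : (Fin l → Fin n) → L2 Ω}
    (h : HasSobolevZeroDeriv u g) (ξ : EuclideanSpace ℝ (Fin n)) :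
    ∑ s, ‖hat (g s) ξ‖ ^ 2 = (2 * π) ^ (2 * l) * (‖ξ‖ ^ (2 * l) * ‖hat u ξ‖ ^ 2) := by
  calc ∑ s, ‖hat (g s) ξ‖ ^ 2
      = (∑ s : Fin l → Fin n, ∏ j, (2 * π * ξ (s j)) ^ 2) * ‖hat u ξ‖ ^ 2 := by
        rw [Finset.sum_mul]
        refine Finset.sum_congr rfl fun s _ => ?_
        rw [h.hat_eq, norm_mul, mul_pow, norm_prod, ← Finset.prod_pow]
        simp [mul_pow]
    _ = (∑ i, (2 * π * ξ i) ^ 2) ^ l * ‖hat u ξ‖ ^ 2 := by rw [Fintype.sum_pow]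
    _ = _ := by
        simp only [mul_pow, ← Finset.mul_sum, ← EuclideanSpace.real_norm_sq_eq, pow_mul]
        ring

-- The Rayleigh quotient of an eigenfunction, computed on the Fourier side.
theorem integral_norm_pow_mul_norm_hat_sq {l : ℕ} {μ : ℝ} {u : L2 Ω}
    (hu : u ∈ eigenspace Ω l μ) :
    Integrable (fun ξ => ‖ξ‖ ^ (2 * l) * ‖hat u ξ‖ ^ 2) ∧
      (2 * π) ^ (2 * l) * ∫ ξ, ‖ξ‖ ^ (2 * l) * ‖hat u ξ‖ ^ 2 = μ * ‖u‖ ^ 2 := by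
  obtain ⟨g, hg⟩ := hu.1.exists_hasSobolevZeroDeriv
  have hint : Integrable fun ξ => (2 * π) ^ (2 * l) * (‖ξ‖ ^ (2 * l) * ‖hat u ξ‖ ^ 2) := by
    simp only [← hg.sum_norm_hat_sq]
    exact integrable_finsetSum _ fun s _ => (plancherel_hat (g s)).1
  refine ⟨(integrable_const_mul_iff (by simp [pi_ne_zero]) _).1 hint, ?_⟩
  calc (2 * π) ^ (2 * l) * ∫ ξ, ‖ξ‖ ^ (2 * l) * ‖hat u ξ‖ ^ 2
      = ∑ s, ∫ ξ, ‖hat (g s) ξ‖ ^ 2 := by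
        rw [← integral_const_mul, ← integral_finsetSum _ fun s _ => (plancherel_hat (g s)).1]
        simp only [hg.sum_norm_hat_sq]
    _ = ∑ s, inner ℝ (g s) (g s) := by
        simp only [(plancherel_hat _).2, real_inner_self_eq_norm_sq]
    _ = μ * ‖u‖ ^ 2 := by rw [← mul_inner_eq_sum_inner hu hg hg, real_inner_self_eq_norm_sq]

variable [NeZero n]

theorem pos_of_mem_eigenspace {l : ℕ} {μ : ℝ} {u : L2 Ω} (hu : u ∈ eigenspace Ω l μ)
    (hu0 : u ≠ 0) : 0 < μ := by
  obtain ⟨hint, heq⟩ := integral_norm_pow_mul_norm_hat_sq hu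
  have hweight : ∀ᵐ ξ : EuclideanSpace ℝ (Fin n), 0 < ‖ξ‖ ^ (2 * l) := by
    filter_upwards [Measure.ae_ne volume (0 : EuclideanSpace ℝ (Fin n))] with ξ hξ
    positivity
  have hmoment : 0 < ∫ ξ, ‖ξ‖ ^ (2 * l) * ‖hat u ξ‖ ^ 2 :=
    integral_mul_pos hweight (.of_forall fun ξ => by positivity)
      (by simpa [(plancherel_hat u).2] using hu0) hint
  exact pos_of_mul_pos_left (heq ▸ by positivity) (sq_nonneg ‖u‖)

theorem IsEigenvalueList.pos {l : ℕ} {ev : ℕ → ℝ} (hev : IsEigenvalueList Ω l ev) (j : ℕ) :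
    0 < ev j := by
  obtain ⟨u, hu, hmem⟩ := hev.exists_orthonormal (j + 1)
  exact pos_of_mem_eigenspace (hmem (Fin.last j)) (hu.ne_zero _)

theorem IsEigenvalueList.sum_rpow_neg_le {l : ℕ} {ev : ℕ → ℝ} (hev : IsEigenvalueList Ω l ev)
    {p : ℝ} (hp : 0 ≤ p) (hpn : 2 * l * p < n) (k : ℕ) :
    ∑ j ∈ Finset.range k, ev j ^ (-p) ≤ (2 * π) ^ (-(2 * l * p)) * (n / (n - 2 * l * p) *
      (volume.real (Ω : Set (EuclideanSpace ℝ (Fin n))) *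
        volume.real (Metric.ball (0 : EuclideanSpace ℝ (Fin n)) 1)) ^ (2 * l * p / n) *
      (k : ℝ) ^ (1 - 2 * l * p / n)) := by
  obtain ⟨u, hu, hmem⟩ := hev.exists_orthonormal k
  have hmoment (j : Fin k) := integral_norm_pow_mul_norm_hat_sq (hmem j)
  have hev_eq (j : Fin k) : ev j ^ (-p) =
      (2 * π) ^ (-(2 * l * p)) * (∫ ξ, ‖ξ‖ ^ (2 * l) * ‖hat (u j) ξ‖ ^ 2) ^ (-p) := by
    have h := (hmoment j).2
    rw [hu.1 j, one_pow, mul_one] at h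
    rw [← h, mul_rpow (by positivity) (integral_nonneg fun ξ => by positivity), ← rpow_natCast,
      ← rpow_mul (by positivity)]
    push_cast
    rw [mul_neg]
  have hsum := sum_integral_norm_rpow_mul_rpow_neg_le (ν := volume) (b := (2 * l : ℕ)) (p := p)
    (F := fun j ξ => ‖hat (u j) ξ‖ ^ 2) (Nat.cast_nonneg _) hp (by simpa using hpn)
    (fun j => .of_forall fun ξ => by positivity)
    (fun j => by rw [(plancherel_hat (u j)).2, hu.1 j, one_pow])
    (fun j => by simpa only [rpow_natCast] using (hmoment j).1)
    (.of_forall fun ξ => sum_norm_hat_sq_le hu ξ)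
  simp only [rpow_natCast] at hsum
  simp only [finrank_euclideanSpace, Fintype.card_fin, Nat.cast_mul, Nat.cast_ofNat] at hsum
  rw [Finset.sum_range]
  simp only [hev_eq, ← Finset.mul_sum]
  gcongr

end Fourier

theorem volume_real_unitBall [NeZero n] :
    volume.real (Metric.ball (0 : EuclideanSpace ℝ (Fin n)) 1) =
      √π ^ n / Gamma (1 + (n : ℝ) / 2) := by
  rw [measureReal_def, EuclideanSpace.volume_ball, Fintype.card_fin, ENNReal.ofReal_one, one_pow,
    one_mul, ENNReal.toReal_ofReal (div_nonneg (by positivity) (Gamma_nonneg_of_nonneg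
      (by positivity))), add_comm (1 : ℝ)]

theorem two_pi_rpow_mul_rpow {d V G a : ℝ} (hd : d ≠ 0) (hV : 0 ≤ V) (hG : 0 ≤ G) :
    (2 * π) ^ (-(2 * a)) * (V * (√π ^ d / G)) ^ (2 * a / d) =
      (4 * π) ^ (-a) * (V / G) ^ (2 * a / d) := by
  have hsqrt : (√π ^ d) ^ (2 * a / d) = π ^ a := by
    rw [← rpow_mul (sqrt_nonneg _), mul_div_cancel₀ _ hd, rpow_mul (sqrt_nonneg _), rpow_two,
      sq_sqrt pi_pos.le]
  have htwo : (2 * π) ^ (-(2 * a)) = (4 * π) ^ (-a) * π ^ (-a) := by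
    rw [← mul_neg, rpow_mul (by positivity), ← mul_rpow (by positivity) pi_pos.le, rpow_two]
    ring_nf
  calc (2 * π) ^ (-(2 * a)) * (V * (√π ^ d / G)) ^ (2 * a / d)
      = (2 * π) ^ (-(2 * a)) * ((V / G) ^ (2 * a / d) * π ^ a) := by
        rw [mul_div_left_comm, mul_comm, mul_rpow (by positivity) (by positivity), hsqrt]
        ring
    _ = (4 * π) ^ (-a) * (V / G) ^ (2 * a / d) * (π ^ (-a) * π ^ a) := by
        rw [htwo]
        ring
    _ = (4 * π) ^ (-a) * (V / G) ^ (2 * a / d) := by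
        rw [← rpow_add pi_pos, neg_add_cancel, rpow_zero, mul_one]

end Polyharmonic

theorem theorem1p4_general {n l : ℕ} {Ω : Opens (EuclideanSpace ℝ (Fin n))}
    (hΩ : volume (Ω : Set (EuclideanSpace ℝ (Fin n))) ≠ ⊤) {ev : ℕ → ℝ}
    (hev : Polyharmonic.IsEigenvalueList Ω l ev) {p : ℝ} (hp : 0 ≤ p) (hpn : 2 * l * p < n)
    (k : ℕ) :
    (∀ j, 0 < ev j) ∧
    ∑ j ∈ Finset.range k, ev j ^ (-p) ≤
      (4 * Real.pi) ^ (-(l * p)) * ((n : ℝ) / (n - 2 * l * p)) *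
        (volume.real (Ω : Set (EuclideanSpace ℝ (Fin n))) /
          Real.Gamma (1 + (n : ℝ) / 2)) ^ (2 * l * p / n) *
        (k : ℝ) ^ (1 - 2 * l * p / n) := by
  have hn : (0 : ℝ) < n := lt_of_le_of_lt (by positivity) hpn
  have : NeZero n := ⟨by exact_mod_cast hn.ne'⟩
  have : IsFiniteMeasure (volume.restrict (Ω : Set (EuclideanSpace ℝ (Fin n)))) :=
    ⟨by simpa using hΩ.lt_top⟩
  have hconst := Polyharmonic.two_pi_rpow_mul_rpow (d := n) (a := l * p) hn.ne'
    (measureReal_nonneg (μ := volume) (s := (Ω : Set (EuclideanSpace ℝ (Fin n)))))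
    (Real.Gamma_nonneg_of_nonneg (s := 1 + (n : ℝ) / 2) (by positivity))
  rw [Real.rpow_natCast, ← Polyharmonic.volume_real_unitBall, ← mul_assoc 2 (l : ℝ)] at hconst
  refine ⟨hev.pos, (hev.sum_rpow_neg_le hp hpn k).trans_eq ?_⟩
  linear_combination (n / (n - 2 * l * p) * (k : ℝ) ^ (1 - 2 * l * p / n)) * hconst

theorem theorem1p4 (n l : ℕ) (hn : 2 ≤ n) (hl : 1 ≤ l)
    (Ω : TopologicalSpace.Opens (EuclideanSpace ℝ (Fin n)))
    (hΩc : IsConnected (Ω : Set (EuclideanSpace ℝ (Fin n))))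
    (hΩb : Bornology.IsBounded (Ω : Set (EuclideanSpace ℝ (Fin n))))
    (ev : ℕ → ℝ) (hev : Polyharmonic.IsEigenvalueList Ω l ev)
    (p : ℝ) (hp : 0 < p) (hpn : p < (n : ℝ) / (2 * l)) (k : ℕ) :
    (∀ j, 0 < ev j) ∧
    ∑ j ∈ Finset.range k, ev j ^ (-p) ≤
      (4 * Real.pi) ^ (-(l * p)) * ((n : ℝ) / (n - 2 * l * p)) *
        (MeasureTheory.volume.real (Ω : Set (EuclideanSpace ℝ (Fin n))) /
          Real.Gamma (1 + (n : ℝ) / 2)) ^ (2 * l * p / n) *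
        (k : ℝ) ^ (1 - 2 * l * p / n) :=
  theorem1p4_general hΩb.measure_lt_top.ne hev hp.le ((lt_div_iff₀' (by positivity)).1 hpn) k
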